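/- For a finite collection $\mathcal F=\{F_1,\dots,F_s\}$ of homogeneous polynomials (forms) in $\mathbb C[x_0,\dots,x_n]$, with $d_i=\deg F_i$ not necessarily equal, the simultaneous Waring rank $\mathrm{rk}_{\mathbb C}\,\mathcal F$ is the least integer $r$ for which there are linear forms $L_1,\dots,L_r\in\mathbb C[x_0,\dots,x_n]$ such that every $F_i$ can be written as $F_i=\sum_{j=1}^r\lambda_{i,j}L_j^{d_i}$ with $\lambda_{i,j}\in\mathbb C$. For a single form $F$, its Waring rank is $\mathrm{rk}_{\mathbb C}\,F=\mathrm{rk}_{\mathbb C}\,\{F\}$. **Proposition.** Let $n\ge 0$ and let $M=x_0^{a_0}\cdots x_n^{a_n}$ be a monomial with integers $a_i>1$ for all $i$. Let $\mathcal M=\{\partial_{x_0}M,\dots,\partial_{x_n}M\}$ be the collection of its first partial derivatives. Then both ranks below are finite, and $$\mathrm{rk}_{\mathbb C}\,\mathcal M=\mathrm{rk}_{\mathbb C}\,M.$$ -/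

import Mathlib

/-- The forms in the set `𝓕` can be simultaneously decomposed by `r` linear forms: there are linear
forms `L 0, …, L (r - 1)` such that every `F ∈ 𝓕` is a `ℂ`-linear combination of the powers
`(L j) ^ deg F`. The degrees of the members of `𝓕` may differ, and so may the coefficients. -/
def HasSimultaneousWaringDecomposition {σ : Type*} (𝓕 : Set (MvPolynomial σ ℂ)) (r : ℕ) : Prop :=
  ∃ L : Fin r → MvPolynomial σ ℂ, (∀ j, (L j).IsHomogeneous 1) ∧
    ∀ F ∈ 𝓕, ∃ c : Fin r → ℂ, F = ∑ j, MvPolynomial.C (c j) * L j ^ F.totalDegree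

/-- The simultaneous Waring rank over `ℂ` of a collection of forms: the least number of linear forms
that decompose all of them simultaneously (`⊤` if there is no such number). -/
noncomputable def simultaneousWaringRank {σ : Type*} (𝓕 : Set (MvPolynomial σ ℂ)) : ℕ∞ :=
  ⨅ r ∈ {r : ℕ | HasSimultaneousWaringDecomposition 𝓕 r}, (r : ℕ∞)

/-- The Waring rank over `ℂ` of a single form. -/
noncomputable def waringRank {σ : Type*} (F : MvPolynomial σ ℂ) : ℕ∞ :=
  simultaneousWaringRank {F}

open MvPolynomial

/-! Let `a k` be the least exponent. Both ranks equal `R = ∏_{i ≠ k} (a i + 1)`. Averaging over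
roots of unity writes `M` with `R` powers, and differentiating a decomposition of `M` decomposes all
its partials with the same linear forms. Conversely, `∂ₖM` alone needs `R` forms: it still contains
`X k`, since `a k > 1`, and its other exponents are those of `M`, so
`le_card_of_monomial_eq_sum_pow` applies. -/

theorem MvPolynomial.IsHomogeneous.eq_sum_smul_X {σ R : Type*} [Fintype σ] [CommSemiring R]
    {L : MvPolynomial σ R} (hL : L.IsHomogeneous 1) :
    L = ∑ i, coeff (Finsupp.single i 1) L • X i := by
  have h := hL.sum_X_mul_pderiv
  rw [one_smul] at h
  conv_lhs => rw [← h]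
  refine Finset.sum_congr rfl fun i _ => ?_
  have h0 : (pderiv i L).totalDegree = 0 := Nat.le_zero.1 (hL.pderiv (i := i)).totalDegree_le
  rw [totalDegree_eq_zero_iff_eq_C.1 h0, coeff_pderiv, mul_comm, C_mul']
  simp

theorem MvPolynomial.coeff_sum_smul_X_pow {σ R : Type*} [Fintype σ] [CommSemiring R]
    (l : σ → R) (s : σ →₀ ℕ) (n : ℕ) :
    coeff s ((∑ i, l i • X i : MvPolynomial σ R) ^ n) =
      if ∑ i, s i = n then s.multinomial * ∏ i, l i ^ s i else 0 := by
  rw [coeff_linearCombination_X_pow_of_fintype, Finsupp.sum_fintype _ _ (fun _ => rfl),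
    Finsupp.prod_fintype _ _ (fun _ => pow_zero _)]

theorem Finsupp.multinomial_pos {σ : Type*} (s : σ →₀ ℕ) : 0 < s.multinomial :=
  Nat.multinomial_pos _ _

theorem IsPrimitiveRoot.sum_pow_pow {K : Type*} [Field K] {ω : K} {m : ℕ}
    (hω : IsPrimitiveRoot ω m) (q : ℕ) :
    ∑ t : Fin m, (ω ^ (t : ℕ)) ^ q = if m ∣ q then (m : K) else 0 := by
  have h1 : ∀ t : Fin m, (ω ^ (t : ℕ)) ^ q = (ω ^ q) ^ (t : ℕ) := fun t => pow_right_comm _ _ _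
  simp_rw [h1]
  rw [Fin.sum_univ_eq_sum_range (fun t => (ω ^ q) ^ t) m]
  split_ifs with h
  · simp [(hω.pow_eq_one_iff_dvd q).2 h]
  · have h2 := mul_neg_geom_sum (ω ^ q) m
    rw [pow_right_comm, hω.pow_eq_one, one_pow, sub_self, mul_eq_zero, sub_eq_zero] at h2
    exact h2.resolve_left fun h3 => h ((hω.pow_eq_one_iff_dvd q).1 h3.symm)

theorem HasSimultaneousWaringDecomposition.of_fintype {σ ι : Type*} [Fintype ι]
    {F : MvPolynomial σ ℂ} (L : ι → MvPolynomial σ ℂ) (hL : ∀ j, (L j).IsHomogeneous 1)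
    (c : ι → ℂ) (h : F = ∑ j, C (c j) * L j ^ F.totalDegree) :
    HasSimultaneousWaringDecomposition {F} (Fintype.card ι) := by
  let e := Fintype.equivFin ι
  refine ⟨fun j => L (e.symm j), fun j => hL _, ?_⟩
  intro G hG
  rw [Set.mem_singleton_iff.1 hG]
  refine ⟨fun j => c (e.symm j), ?_⟩
  rwa [e.symm.sum_comp (fun j => C (c j) * L j ^ F.totalDegree)]

/-- The weighted sum over roots of unity keeps only the exponents `b` with `m i ∣ b i + 1` for all
`i`; in degree `∑ a i`, minimality of `a k` leaves only `b = a`. -/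
theorem hasSimultaneousWaringDecomposition_monomial {σ : Type*} [Fintype σ] [DecidableEq σ]
    (a : σ →₀ ℕ) (k : σ) (hk : ∀ i, a k ≤ a i) :
    HasSimultaneousWaringDecomposition {monomial a (1 : ℂ)}
      (∏ i, if i = k then 1 else a i + 1) := by
  set m : σ → ℕ := fun i => if i = k then 1 else a i + 1 with hm
  have hm0 : ∀ i, m i ≠ 0 := fun i => by simp only [hm]; split_ifs <;> omega
  set ω : σ → ℂ := fun i => Complex.exp (2 * Real.pi * Complex.I / m i)
  have hω : ∀ i, IsPrimitiveRoot (ω i) (m i) := fun i => Complex.isPrimitiveRoot_exp _ (hm0 i)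
  have hcard : Fintype.card (∀ i, Fin (m i)) = ∏ i, m i := by simp
  have hdeg : (monomial a (1 : ℂ)).totalDegree = ∑ i, a i := by
    rw [totalDegree_monomial _ one_ne_zero, Finsupp.sum_fintype _ _ (fun _ => rfl)]
  have hN : (a.multinomial * ∏ i, (m i : ℂ)) ≠ 0 :=
    mul_ne_zero (Nat.cast_ne_zero.2 a.multinomial_pos.ne')
      (Finset.prod_ne_zero_iff.2 fun i _ => Nat.cast_ne_zero.2 (hm0 i))
  rw [← hcard]
  refine .of_fintype (fun s => ∑ i, (ω i ^ (s i : ℕ)) • X i) (fun s => ?_)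
    (fun s => (a.multinomial * ∏ i, (m i : ℂ))⁻¹ * ∏ i, ω i ^ (s i : ℕ)) ?_
  · exact IsHomogeneous.sum _ _ _ fun i _ => by
      simpa only [smul_eq_C_mul] using (isHomogeneous_X ℂ i).C_mul _
  rw [hdeg]
  ext b
  simp_rw [coeff_sum, coeff_C_mul, coeff_sum_smul_X_pow, coeff_monomial]
  by_cases hb : ∑ i, b i = ∑ i, a i
  · have key : ∑ s : (∀ i, Fin (m i)), (∏ i, ω i ^ (s i : ℕ)) * ∏ i, (ω i ^ (s i : ℕ)) ^ b i
        = ∏ i, if m i ∣ b i + 1 then (m i : ℂ) else 0 := by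
      simp_rw [← Finset.prod_mul_distrib, ← pow_succ', ← fun i => (hω i).sum_pow_pow (b i + 1)]
      rw [Finset.prod_univ_sum, Fintype.piFinset_univ]
    simp_rw [if_pos hb]
    have h2 : ∀ s : (∀ i, Fin (m i)), (a.multinomial * ∏ i, (m i : ℂ))⁻¹ *
        (∏ i, ω i ^ (s i : ℕ)) * (b.multinomial * ∏ i, (ω i ^ (s i : ℕ)) ^ b i) =
        (a.multinomial * ∏ i, (m i : ℂ))⁻¹ * b.multinomial *
        ((∏ i, ω i ^ (s i : ℕ)) * ∏ i, (ω i ^ (s i : ℕ)) ^ b i) := fun s => by ring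
    simp_rw [h2]
    rw [← Finset.mul_sum, key]
    split_ifs with hab
    · subst hab
      rw [Finset.prod_congr rfl fun i _ => if_pos _, mul_assoc, inv_mul_cancel₀ hN]
      intro i
      simp only [hm]
      split_ifs <;> simp
    · by_cases hd : ∀ i, m i ∣ b i + 1
      · have hle : ∀ i, i ≠ k → a i ≤ b i := fun i hi => by
          have := Nat.le_of_dvd (by omega) (hd i)
          simp only [hm, if_neg hi] at this
          omega
        have hlt : ∀ i, i ≠ k → a i = b i := by
          intro i hi
          by_contra hne
          obtain ⟨q, hq⟩ := hd i
          simp only [hm, if_neg hi] at hq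
          have hq2 : 2 ≤ q := by
            by_contra hlt
            have : q = 0 ∨ q = 1 := by omega
            rcases this with rfl | rfl <;> omega
          -- The excess `b i - a i` is at least `a i + 1 > a k`, more than lowering the exponent at
          -- `k` can offset.
          have h3 : 2 * (a i + 1) ≤ b i + 1 := by rw [hq]; nlinarith
          have h4 := hk i
          have h5 : ∑ j, a j < ∑ j, b j := by
            rw [← Finset.sum_erase_add _ _ (Finset.mem_univ k),
              ← Finset.sum_erase_add _ b (Finset.mem_univ k),
              ← Finset.sum_erase_add _ a (Finset.mem_erase.2 ⟨hi, Finset.mem_univ i⟩),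
              ← Finset.sum_erase_add _ b (Finset.mem_erase.2 ⟨hi, Finset.mem_univ i⟩)]
            have : ∑ x ∈ (Finset.univ.erase k).erase i, a x ≤
                ∑ x ∈ (Finset.univ.erase k).erase i, b x :=
              Finset.sum_le_sum fun j hj => hle j (by simp at hj; exact hj.2)
            omega
          omega
        refine absurd (Finsupp.ext fun i => ?_) hab
        by_cases hi : i = k
        · subst hi
          have h1 : ∑ j ∈ Finset.univ.erase i, a j = ∑ j ∈ Finset.univ.erase i, b j :=
            Finset.sum_congr rfl fun j hj => hlt j (Finset.ne_of_mem_erase hj)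
          rw [← Finset.sum_erase_add _ b (Finset.mem_univ i),
            ← Finset.sum_erase_add _ a (Finset.mem_univ i), h1] at hb
          exact (Nat.add_left_cancel hb).symm
        · exact hlt i hi
      · push Not at hd
        obtain ⟨i, hi⟩ := hd
        have h0 : ∏ i, (if m i ∣ b i + 1 then (m i : ℂ) else 0) = 0 :=
          Finset.prod_eq_zero (Finset.mem_univ i) (if_neg hi)
        rw [h0, mul_zero]
  · simp_rw [if_neg hb]
    rw [if_neg fun h => hb (by rw [h])]
    simp

/-- An apolarity argument: the functional `x ^ b ↦ ∑ j, c j * l j ^ b` on forms of degree `∑ e i` is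
nonzero on `x ^ e` and kills every other monomial. Hence no form vanishing at all the points `l j`
contains `x ^ e`. -/
theorem le_card_of_monomial_eq_sum_pow {σ : Type*} [Fintype σ] [DecidableEq σ]
    (e : σ →₀ ℕ) (k : σ) (hk : e k ≠ 0) {z : ℂ} (hz : z ≠ 0) {r : ℕ}
    (L : Fin r → MvPolynomial σ ℂ) (hL : ∀ j, (L j).IsHomogeneous 1) (c : Fin r → ℂ)
    (h : monomial e z = ∑ j, C (c j) * L j ^ (∑ i, e i)) :
    ∏ i, (if i = k then 1 else e i + 1) ≤ r := by
  set m : σ → ℕ := fun i => if i = k then 1 else e i + 1 with hm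
  choose! l hl using fun j => (⟨_, (hL j).eq_sum_smul_X⟩ : ∃ l : σ → ℂ, L j = ∑ i, l i • X i)
  have hmom : ∀ b : σ →₀ ℕ, ∑ i, b i = ∑ i, e i →
      (b.multinomial : ℂ) * ∑ j, c j * ∏ i, l j i ^ b i = if e = b then z else 0 := by
    intro b hb
    have := congrArg (coeff b) h
    simp_rw [hl, coeff_sum, coeff_C_mul, coeff_sum_smul_X_pow, coeff_monomial, if_pos hb] at this
    rw [this, Finset.mul_sum]
    exact Finset.sum_congr rfl fun j _ => by ring
  -- Values of the monomials dividing `x ^ e` and free of `x k`, in the chart `x k = 1`; points at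
  -- infinity get `0`. Independence in `ℂ ^ r` gives the bound.
  let v : (∀ i, Fin (m i)) → Fin r → ℂ := fun b j =>
    if l j k = 0 then 0 else ∏ i, (l j i / l j k) ^ (b i : ℕ)
  have hbk : ∀ b : (∀ i, Fin (m i)), (b k : ℕ) = 0 := fun b => by
    have := (b k).2
    simp only [hm, if_true] at this
    omega
  have hbe : ∀ (b : ∀ i, Fin (m i)) i, (b i : ℕ) ≤ e i := fun b i => by
    have := (b i).2
    simp only [hm] at this
    split_ifs at this <;> omega
  have hv : LinearIndependent ℂ v := by
    rw [Fintype.linearIndependent_iff]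
    intro g hg
    by_contra! hne
    -- Maximal degree lets the relation be homogenized by powers of `x k` without touching its `b₀`
    -- term.
    obtain ⟨b₀, hb₀, hmax⟩ := (Finset.univ.filter fun b => g b ≠ 0).exists_max_image
      (fun b => ∑ i, (b i : ℕ)) (by obtain ⟨b, hb⟩ := hne; exact ⟨b, by simpa using hb⟩)
    simp only [Finset.mem_filter, Finset.mem_univ, true_and] at hb₀ hmax
    -- the exponent obtained from `b` by homogenizing and multiplying by `x ^ (e - b₀)`
    let E : (∀ i, Fin (m i)) → (σ →₀ ℕ) := fun b => Finsupp.equivFunOnFinite.symm fun i =>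
      (b i + (e i - b₀ i)) + if i = k then ∑ i, (b₀ i : ℕ) - ∑ i, (b i : ℕ) else 0
    have hE : ∀ b i, E b i =
      (b i + (e i - b₀ i)) + if i = k then ∑ i, (b₀ i : ℕ) - ∑ i, (b i : ℕ) else 0 := fun _ _ => rfl
    have hEdeg : ∀ b, g b ≠ 0 → ∑ i, E b i = ∑ i, e i := by
      intro b hb
      have h1 : ∑ i, (e i - b₀ i) + ∑ i, (b₀ i : ℕ) = ∑ i, e i := by
        rw [← Finset.sum_add_distrib]
        exact Finset.sum_congr rfl fun i _ => Nat.sub_add_cancel (hbe b₀ i)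
      have h2 := hmax b hb
      simp_rw [hE, Finset.sum_add_distrib, Finset.sum_ite_eq', Finset.mem_univ, if_true]
      omega
    have hE0 : E b₀ = e := by
      ext i
      have := hbe b₀ i
      simp only [hE, Nat.sub_self, ite_self]
      omega
    have hEne : ∀ b, e = E b → b = b₀ := by
      intro b hb
      funext i
      apply Fin.ext
      by_cases hi : i = k
      · subst hi; rw [hbk, hbk]
      · have h1 := DFunLike.congr_fun hb i
        have h2 := hbe b₀ i
        rw [hE, if_neg hi] at h1
        omega
    have hpow : ∀ b, g b ≠ 0 → ∀ j, ∏ i, l j i ^ E b i =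
        v b j * (l j k ^ (∑ i, (b₀ i : ℕ)) * ∏ i, l j i ^ (e i - b₀ i)) := by
      intro b hb j
      by_cases h0 : l j k = 0
      -- At infinity the monomial vanishes too: `b₀ k = 0` and `e k ≠ 0` leave a factor `x k`.
      · simp only [v, if_pos h0, zero_mul]
        refine Finset.prod_eq_zero (Finset.mem_univ k) ?_
        rw [h0, zero_pow]
        have := hbk b₀
        rw [hE]
        omega
      · simp only [v, if_neg h0, hE, pow_add, Finset.prod_mul_distrib, div_pow,
          Finset.prod_div_distrib, Finset.prod_pow_eq_pow_sum]
        have h2 (N : ℕ) : ∏ i, l j i ^ (if i = k then N else 0) = l j k ^ N := by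
          rw [Finset.prod_eq_single k (fun i _ hi => by rw [if_neg hi, pow_zero]) (by simp),
            if_pos rfl]
        rw [h2]
        have h1 : l j k ^ (∑ i, (b₀ i : ℕ)) =
            l j k ^ (∑ i, (b i : ℕ)) * l j k ^ (∑ i, (b₀ i : ℕ) - ∑ i, (b i : ℕ)) := by
          rw [← pow_add, Nat.add_sub_cancel' (hmax b hb)]
        rw [h1]
        field_simp
    have hvan : ∀ j, ∑ b, g b * ∏ i, l j i ^ E b i = 0 := by
      intro j
      have h1 : ∀ b, g b * ∏ i, l j i ^ E b i =
          g b * v b j * (l j k ^ (∑ i, (b₀ i : ℕ)) * ∏ i, l j i ^ (e i - b₀ i)) := by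
        intro b
        by_cases hb : g b = 0
        · simp [hb]
        · rw [hpow b hb, mul_assoc]
      simp_rw [h1]
      rw [← Finset.sum_mul]
      have h2 := congrFun hg j
      simp only [Finset.sum_apply, Pi.smul_apply, smul_eq_mul, Pi.zero_apply] at h2
      rw [h2, zero_mul]
    have hsum : ∑ b, g b * ∑ j, c j * ∏ i, l j i ^ E b i = 0 := by
      simp_rw [Finset.mul_sum]
      rw [Finset.sum_comm]
      refine Finset.sum_eq_zero fun j _ => ?_
      have := congrArg (c j * ·) (hvan j)
      simp only [Finset.mul_sum, mul_zero] at this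
      rw [← this]
      exact Finset.sum_congr rfl fun b _ => by ring
    rw [Finset.sum_eq_single b₀ _ (by simp), mul_eq_zero] at hsum
    · have h1 := hmom _ (hEdeg b₀ hb₀)
      rw [hsum.resolve_left hb₀, mul_zero, if_pos hE0.symm] at h1
      exact hz h1.symm
    · intro b _ hb
      by_cases hgb : g b = 0
      · rw [hgb, zero_mul]
      · have h1 := hmom _ (hEdeg b hgb)
        rw [if_neg fun h => hb (hEne b h)] at h1
        rw [(mul_eq_zero.1 h1).resolve_left
          (Nat.cast_ne_zero.2 (Finsupp.multinomial_pos _).ne'), mul_zero]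
  simpa using hv.fintype_card_le_finrank

/-- By the chain rule `∂ᵢ(L ^ d) = d * ∂ᵢL * L ^ (d - 1)`, where `∂ᵢL` is a constant. -/
theorem HasSimultaneousWaringDecomposition.range_pderiv {σ : Type*} {M : MvPolynomial σ ℂ}
    {d r : ℕ} (hM : M.IsHomogeneous d)
    (h : HasSimultaneousWaringDecomposition {M} r) :
    HasSimultaneousWaringDecomposition (Set.range fun i => pderiv i M) r := by
  obtain ⟨L, hL, hc⟩ := h
  obtain ⟨c, hc⟩ := hc M rfl
  refine ⟨L, hL, ?_⟩
  rintro _ ⟨i, rfl⟩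
  dsimp only
  by_cases h0 : pderiv i M = 0
  · exact ⟨0, by simp [h0]⟩
  have hM0 : M ≠ 0 := by rintro rfl; simp at h0
  rw [hM.totalDegree hM0] at hc
  rw [(hM.pderiv (i := i)).totalDegree h0]
  have hC : ∀ j, pderiv i (L j) = C (coeff 0 (pderiv i (L j))) := fun j =>
    totalDegree_eq_zero_iff_eq_C.1 (Nat.le_zero.1 ((hL j).pderiv (i := i)).totalDegree_le)
  refine ⟨fun j => c j * d * coeff 0 (pderiv i (L j)), ?_⟩
  conv_lhs => rw [hc]
  rw [map_sum]
  refine Finset.sum_congr rfl fun j _ => ?_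
  rw [pderiv_C_mul, pderiv_pow, hC, C_mul, C_mul, map_natCast]
  ring

theorem simultaneousWaringRank_le {σ : Type*} {𝓕 : Set (MvPolynomial σ ℂ)} {r : ℕ}
    (h : HasSimultaneousWaringDecomposition 𝓕 r) : simultaneousWaringRank 𝓕 ≤ r :=
  iInf₂_le r h

theorem mainTheorem5 (n : ℕ) (a : Fin (n + 1) → ℕ) (ha : ∀ i, 1 < a i)
    (M : MvPolynomial (Fin (n + 1)) ℂ) (hM : M = ∏ i, MvPolynomial.X i ^ a i) :
    simultaneousWaringRank (Set.range fun i : Fin (n + 1) => MvPolynomial.pderiv i M) ≠ ⊤ ∧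
      waringRank M ≠ ⊤ ∧
      simultaneousWaringRank (Set.range fun i : Fin (n + 1) => MvPolynomial.pderiv i M) =
        waringRank M := by
  obtain ⟨k, hk⟩ := Finite.exists_min a
  set e : Fin (n + 1) →₀ ℕ := Finsupp.equivFunOnFinite.symm a with he
  have hei : ∀ i, e i = a i := fun _ => rfl
  have hMe : M = monomial e 1 := by
    rw [hM, monomial_eq, C_1, one_mul, Finsupp.prod_fintype _ _ (fun _ => pow_zero _)]
    rfl
  have hhom : M.IsHomogeneous e.degree := hMe ▸ isHomogeneous_monomial _ rfl
  set R : ℕ := ∏ i, if i = k then 1 else e i + 1 with hR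
  have hup : HasSimultaneousWaringDecomposition {M} R :=
    hMe ▸ hasSimultaneousWaringDecomposition_monomial e k hk
  have hupper : waringRank M ≤ R := simultaneousWaringRank_le hup
  have hle : simultaneousWaringRank (Set.range fun i => pderiv i M) ≤ waringRank M :=
    le_iInf₂ fun r hr => simultaneousWaringRank_le (hr.range_pderiv hhom)
  have hlower : (R : ℕ∞) ≤ simultaneousWaringRank (Set.range fun i => pderiv i M) := by
    refine le_iInf₂ fun r hr => Nat.cast_le.2 ?_
    obtain ⟨L, hL, hc⟩ := hr
    obtain ⟨c, hc⟩ := hc _ ⟨k, rfl⟩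
    have hz : (1 * (e k : ℂ)) ≠ 0 := by
      have := ha k
      rw [one_mul, Nat.cast_ne_zero, hei]
      omega
    simp only [hMe, pderiv_monomial] at hc
    rw [totalDegree_monomial _ hz,
      Finsupp.sum_fintype _ _ (fun _ => rfl)] at hc
    have := le_card_of_monomial_eq_sum_pow _ k (by
      have := ha k
      rw [Finsupp.tsub_apply, Finsupp.single_eq_same, hei]
      omega) hz L hL c hc
    refine (Finset.prod_congr rfl fun i _ => ?_).trans_le this
    split_ifs with hi
    · rfl
    · simp [Finsupp.tsub_apply, hi]
  have htop : waringRank M ≠ ⊤ := ne_top_of_le_ne_top (ENat.natCast_ne_top R) hupper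
  exact ⟨ne_top_of_le_ne_top htop hle, htop, hle.antisymm (hupper.trans hlower)⟩
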